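/- Let $n \ge 0$ and let $w \in S_n$, written in one-line notation $w_1 w_2 \cdots w_n$. Let $\mathfrak{S}_w \in \mathbb{Z}[x_1, x_2, \dots]$ be the Schubert polynomial of $w$, defined by $\mathfrak{S}_{w_0} = x_1^{n-1} x_2^{n-2} \cdots x_{n-1}$ for the longest element $w_0 = n\,(n-1) \cdots 1$ of $S_n$, and by $\mathfrak{S}_{w} = \partial_i \mathfrak{S}_{ws_i}$ whenever $w_i < w_{i+1}$, where $s_i$ is the transposition $(i, i+1)$ and $\partial_i f = (f - s_i f)/(x_i - x_{i+1})$ is the divided difference operator. For $i \ge 1$ and $j \ge 0$ let $h^i_j$ be the complete homogeneous symmetric polynomial of degree $j$ in the $i$ variables $x_1, \dots, x_i$; a complete homogeneous monomial is a product $h_{\vec a} = \prod_{i \ge 1} h^i_{a_i}$, where $\vec a = (a_1, a_2, \dots)$ is a sequence of nonnegative integers with only finitely many nonzero entries. Let $L(w) = (L_1, \dots, L_n)$, $L_i = |\{ j > i : w_j < w_i \}|$, be the Lehmer code of $w$. Then $\mathfrak{S}_w$ is a complete homogeneous monomial if and only if $w$ avoids the patterns $321$ and $231$. In that case $$\mathfrak{S}_w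 = h_{L(w)} = \prod_{i=1}^{n} h^i_{L_i}.$$ -/

import Mathlib

namespace Schubert

open MvPolynomial

/-! The variables `x₁, x₂, …` are `X 0, X 1, …`, so `x_{i+1}` is `X i`.  A permutation `w ∈ S_n` is
an element of `Equiv.Perm (Fin n)`, and its positions and values are numbered from `0`. -/

/-- The action on polynomials of the simple transposition that exchanges `X i` and `X (i + 1)`. -/
noncomputable def simpleAct (i : ℕ) (f : MvPolynomial ℕ ℤ) : MvPolynomial ℕ ℤ :=
  rename (Equiv.swap i (i + 1)) f

theorem dvd_sub_simpleAct (i : ℕ) (f : MvPolynomial ℕ ℤ) :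
    (X i - X (i + 1) : MvPolynomial ℕ ℤ) ∣ f - simpleAct i f := by
  unfold simpleAct
  induction f using MvPolynomial.induction_on with
  | C a => simp
  | add p q hp hq =>
    rw [map_add, add_sub_add_comm]
    exact dvd_add hp hq
  | mul_X p j hp =>
    have hX : (X i - X (i + 1) : MvPolynomial ℕ ℤ) ∣ X j - X (Equiv.swap i (i + 1) j) := by
      rcases eq_or_ne j i with rfl | h1
      · simp
      rcases eq_or_ne j (i + 1) with rfl | h2
      · rw [Equiv.swap_apply_right]
        exact ⟨-1, by ring⟩
      · simp [Equiv.swap_apply_of_ne_of_ne h1 h2]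
    rw [map_mul, rename_X]
    have e : p * X j - rename (Equiv.swap i (i + 1)) p * X (Equiv.swap i (i + 1) j)
        = (p - rename (Equiv.swap i (i + 1)) p) * X j
          + rename (Equiv.swap i (i + 1)) p * (X j - X (Equiv.swap i (i + 1) j)) := by ring
    rw [e]
    exact dvd_add (hp.mul_right _) (hX.mul_left _)

/-- The divided difference operator `∂ f = (f - s f) / (X i - X (i + 1))`, the exact quotient. -/
noncomputable def divDiff (i : ℕ) (f : MvPolynomial ℕ ℤ) : MvPolynomial ℕ ℤ :=
  Classical.choose (dvd_sub_simpleAct i f)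

theorem mul_divDiff (i : ℕ) (f : MvPolynomial ℕ ℤ) :
    (X i - X (i + 1)) * divDiff i f = f - simpleAct i f :=
  (Classical.choose_spec (dvd_sub_simpleAct i f)).symm

/-- The permutation `w sᵢ`: the one-line notation of `w` with the entries in the positions `i` and
`i + 1` exchanged. -/
def mulSimple {n : ℕ} (w : Equiv.Perm (Fin n)) (i : ℕ) (hi : i + 1 < n) : Equiv.Perm (Fin n) :=
  w * Equiv.swap ⟨i, Nat.lt_of_succ_lt hi⟩ ⟨i + 1, hi⟩

/-- The position `i` is an ascent of `w`. -/
def IsAscent {n : ℕ} (w : Equiv.Perm (Fin n)) (i : ℕ) : Prop :=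
  ∃ hi : i + 1 < n, w ⟨i, Nat.lt_of_succ_lt hi⟩ < w ⟨i + 1, hi⟩

/-- A quantity that drops at every step up in the weak order (used only for termination). -/
def weight {n : ℕ} (w : Equiv.Perm (Fin n)) : ℕ := ∑ j : Fin n, (j : ℕ) * (w j : ℕ)

theorem weight_mulSimple_lt {n : ℕ} (w : Equiv.Perm (Fin n)) (i : ℕ) (hi : i + 1 < n)
    (h : w ⟨i, Nat.lt_of_succ_lt hi⟩ < w ⟨i + 1, hi⟩) :
    weight (mulSimple w i hi) < weight w := by
  set a : Fin n := ⟨i, Nat.lt_of_succ_lt hi⟩ with ha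
  set b : Fin n := ⟨i + 1, hi⟩ with hb
  have hab : b ≠ a := by simp [ha, hb]
  have hb' : b ∈ Finset.univ.erase a := by simp [hab]
  unfold weight
  rw [← Finset.add_sum_erase _ _ (Finset.mem_univ a), ← Finset.add_sum_erase _ _ hb',
    ← Finset.add_sum_erase Finset.univ (fun j : Fin n => (j : ℕ) * (w j : ℕ)) (Finset.mem_univ a),
    ← Finset.add_sum_erase _ (fun j : Fin n => (j : ℕ) * (w j : ℕ)) hb']
  have hrest : ∑ x ∈ (Finset.univ.erase a).erase b, (x : ℕ) * (mulSimple w i hi x : ℕ)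
      = ∑ x ∈ (Finset.univ.erase a).erase b, (x : ℕ) * (w x : ℕ) := by
    refine Finset.sum_congr rfl fun x hx => ?_
    simp only [Finset.mem_erase, Finset.mem_univ, and_true] at hx
    simp [mulSimple, ← ha, ← hb, Equiv.swap_apply_of_ne_of_ne hx.2 hx.1]
  have h1 : mulSimple w i hi a = w b := by simp [mulSimple, ← ha, ← hb]
  have h2 : mulSimple w i hi b = w a := by simp [mulSimple, ← ha, ← hb]
  rw [hrest, h1, h2]
  have h' : (w a : ℕ) < (w b : ℕ) := h
  have ea : (a : ℕ) = i := rfl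
  have eb : (b : ℕ) = i + 1 := rfl
  rw [ea, eb]
  nlinarith

open Classical in
/-- The Schubert polynomial of `w ∈ S_n`.  If `w` has no ascent, then `w` is the longest element and
the value is the staircase monomial `x₁^{n-1} x₂^{n-2} ⋯ x_{n-1}`; otherwise it is `∂ᵢ` of the
Schubert polynomial of `w sᵢ`, where `i` is the first ascent.  By `schubert_of_isAscent` below
every ascent gives the same polynomial. -/
noncomputable def schubert {n : ℕ} (w : Equiv.Perm (Fin n)) : MvPolynomial ℕ ℤ :=
  if h : ∃ i, IsAscent w i then
    divDiff (Nat.find h) (schubert (mulSimple w (Nat.find h) (Nat.find_spec h).1))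
  else ∏ j : Fin n, X (j : ℕ) ^ (n - 1 - (j : ℕ))
termination_by weight w
decreasing_by exact weight_mulSimple_lt w _ _ (Nat.find_spec h).2

/-! The recursion does not depend on the choice of the ascent. -/

theorem X_sub_X_ne_zero {i j : ℕ} (h : i ≠ j) : (X i - X j : MvPolynomial ℕ ℤ) ≠ 0 :=
  sub_ne_zero.mpr fun e => h (X_injective e)

theorem simpleAct_simpleAct (i : ℕ) (f : MvPolynomial ℕ ℤ) :
    simpleAct i (simpleAct i f) = f := by
  unfold simpleAct
  rw [rename_rename]
  have : (Equiv.swap i (i + 1) ∘ Equiv.swap i (i + 1) : ℕ → ℕ) = id := by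
    funext x; simp
  rw [this, rename_id_apply]

theorem simpleAct_divDiff (i : ℕ) (f : MvPolynomial ℕ ℤ) :
    simpleAct i (divDiff i f) = divDiff i f := by
  have h := mul_divDiff i f
  have h' := congrArg (simpleAct i) h
  have e : simpleAct i (f - simpleAct i f) = simpleAct i f - f := by
    have e0 : simpleAct i (f - simpleAct i f) = simpleAct i f - simpleAct i (simpleAct i f) := by
      simp only [simpleAct, map_sub]
    rw [e0, simpleAct_simpleAct]
  rw [e] at h'
  simp only [simpleAct, map_mul, map_sub, rename_X, Equiv.swap_apply_left,
    Equiv.swap_apply_right] at h' h ⊢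
  apply mul_left_cancel₀ (X_sub_X_ne_zero (Nat.succ_ne_self i).symm)
  linear_combination -h' - h

theorem divDiff_divDiff_self (i : ℕ) (f : MvPolynomial ℕ ℤ) : divDiff i (divDiff i f) = 0 := by
  have h := mul_divDiff i (divDiff i f)
  rw [simpleAct_divDiff, sub_self] at h
  exact (mul_eq_zero.mp h).resolve_left (X_sub_X_ne_zero (Nat.succ_ne_self i).symm)

theorem simpleAct_comm {i j : ℕ} (hij : i + 1 < j) (f : MvPolynomial ℕ ℤ) :
    simpleAct i (simpleAct j f) = simpleAct j (simpleAct i f) := by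
  unfold simpleAct
  rw [rename_rename, rename_rename]
  congr 1
  congr 1
  funext x
  simp only [Function.comp, Equiv.swap_apply_def]
  grind

theorem divDiff_comm {i j : ℕ} (hij : i + 1 < j) (f : MvPolynomial ℕ ℤ) :
    divDiff i (divDiff j f) = divDiff j (divDiff i f) := by
  have a1 := mul_divDiff j f
  have a2 := mul_divDiff i (divDiff j f)
  have b1 := mul_divDiff i f
  have b2 := mul_divDiff j (divDiff i f)
  have a1' := congrArg (simpleAct i) a1
  have b1' := congrArg (simpleAct j) b1
  have hc := simpleAct_comm hij f
  have e1 : Equiv.swap i (i + 1) j = j := Equiv.swap_apply_of_ne_of_ne (by omega) (by omega)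
  have e2 : Equiv.swap i (i + 1) (j + 1) = j + 1 :=
    Equiv.swap_apply_of_ne_of_ne (by omega) (by omega)
  have e3 : Equiv.swap j (j + 1) i = i := Equiv.swap_apply_of_ne_of_ne (by omega) (by omega)
  have e4 : Equiv.swap j (j + 1) (i + 1) = i + 1 :=
    Equiv.swap_apply_of_ne_of_ne (by omega) (by omega)
  simp only [simpleAct, map_mul, map_sub, rename_X, e1, e2, e3, e4] at a1 a2 b1 b2 a1' b1' hc
  apply mul_left_cancel₀ (X_sub_X_ne_zero (Nat.succ_ne_self i).symm)
  apply mul_left_cancel₀ (X_sub_X_ne_zero (Nat.succ_ne_self j).symm)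
  linear_combination (X j - X (j + 1)) * a2 - (X i - X (i + 1)) * b2 + a1 - a1' - b1 + b1' + hc

theorem simpleAct_braid (i : ℕ) (f : MvPolynomial ℕ ℤ) :
    simpleAct i (simpleAct (i + 1) (simpleAct i f))
      = simpleAct (i + 1) (simpleAct i (simpleAct (i + 1) f)) := by
  unfold simpleAct
  simp only [rename_rename]
  congr 1
  congr 1
  funext x
  simp only [Function.comp, Equiv.swap_apply_def]
  grind

theorem divDiff_braid (i : ℕ) (f : MvPolynomial ℕ ℤ) :
    divDiff i (divDiff (i + 1) (divDiff i f))
      = divDiff (i + 1) (divDiff i (divDiff (i + 1) f)) := by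
  have e1 : Equiv.swap i (i + 1) (i + 1 + 1) = i + 1 + 1 :=
    Equiv.swap_apply_of_ne_of_ne (by omega) (by omega)
  have e2 : Equiv.swap (i + 1) (i + 1 + 1) i = i :=
    Equiv.swap_apply_of_ne_of_ne (by omega) (by omega)
  have p1 := mul_divDiff i f
  have p2 := mul_divDiff (i + 1) (divDiff i f)
  have p3 := mul_divDiff i (divDiff (i + 1) (divDiff i f))
  have p2' := congrArg (simpleAct i) p2
  have p1' := congrArg (simpleAct (i + 1)) p1
  have p1'' := congrArg (simpleAct i) p1'
  have ps := simpleAct_divDiff i f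
  have q1 := mul_divDiff (i + 1) f
  have q2 := mul_divDiff i (divDiff (i + 1) f)
  have q3 := mul_divDiff (i + 1) (divDiff i (divDiff (i + 1) f))
  have q2' := congrArg (simpleAct (i + 1)) q2
  have q1' := congrArg (simpleAct i) q1
  have q1'' := congrArg (simpleAct (i + 1)) q1'
  have qs := simpleAct_divDiff (i + 1) f
  have hb := simpleAct_braid i f
  simp only [simpleAct, map_mul, map_sub, rename_X, e1, e2, Equiv.swap_apply_left,
    Equiv.swap_apply_right] at *
  rw [ps] at p2'
  rw [qs] at q2'
  apply mul_left_cancel₀ (X_sub_X_ne_zero (show i ≠ i + 1 by omega))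
  apply mul_left_cancel₀ (X_sub_X_ne_zero (show i + 1 ≠ i + 1 + 1 by omega))
  apply mul_left_cancel₀ (X_sub_X_ne_zero (show i ≠ i + 1 + 1 by omega))
  set a : MvPolynomial ℕ ℤ := X i
  set b : MvPolynomial ℕ ℤ := X (i + 1)
  set c : MvPolynomial ℕ ℤ := X (i + 1 + 1)
  linear_combination (b - c) * (a - c) * p3 + (a - c) * p2 - (b - c) * p2' + p1 - p1' + p1''
    - ((a - b) * (a - c) * q3 + (a - c) * q2 - (a - b) * q2' + q1 - q1' + q1'') - hb

theorem mulSimple_val {n : ℕ} (w : Equiv.Perm (Fin n)) (i : ℕ) (hi : i + 1 < n) (x : Fin n) :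
    mulSimple w i hi x = w (if (x : ℕ) = i then ⟨i + 1, hi⟩
      else if (x : ℕ) = i + 1 then ⟨i, Nat.lt_of_succ_lt hi⟩ else x) := by
  simp only [mulSimple, Equiv.Perm.mul_apply, Equiv.swap_apply_def, Fin.ext_iff]

theorem mulSimple_comm {n : ℕ} (w : Equiv.Perm (Fin n)) {i j : ℕ} (hi : i + 1 < n) (hj : j + 1 < n)
    (hij : i + 1 < j) :
    mulSimple (mulSimple w i hi) j hj = mulSimple (mulSimple w j hj) i hi := by
  ext x
  simp only [mulSimple_val]
  congr 2
  ext
  grind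

theorem mulSimple_braid {n : ℕ} (w : Equiv.Perm (Fin n)) {i : ℕ} (hi : i + 1 < n)
    (hj : i + 1 + 1 < n) :
    mulSimple (mulSimple (mulSimple w i hi) (i + 1) hj) i hi
      = mulSimple (mulSimple (mulSimple w (i + 1) hj) i hi) (i + 1) hj := by
  ext x
  simp only [mulSimple_val]
  congr 2
  ext
  grind

theorem divDiff_schubert_eq {n : ℕ} (w : Equiv.Perm (Fin n))
    (ih : ∀ v : Equiv.Perm (Fin n), weight v < weight w → ∀ i (hi : i + 1 < n),
      v ⟨i, Nat.lt_of_succ_lt hi⟩ < v ⟨i + 1, hi⟩ →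
        schubert v = divDiff i (schubert (mulSimple v i hi)))
    {i j : ℕ} (hij : i < j) (hi : i + 1 < n) (hj : j + 1 < n)
    (ai : w ⟨i, Nat.lt_of_succ_lt hi⟩ < w ⟨i + 1, hi⟩)
    (aj : w ⟨j, Nat.lt_of_succ_lt hj⟩ < w ⟨j + 1, hj⟩) :
    divDiff i (schubert (mulSimple w i hi)) = divDiff j (schubert (mulSimple w j hj)) := by
  have wi := weight_mulSimple_lt w i hi ai
  have wj := weight_mulSimple_lt w j hj aj
  rcases Nat.lt_or_ge (i + 1) j with hlt | hge
  · have n1 : j ≠ i := by omega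
    have n2 : j ≠ i + 1 := by omega
    have n3 : j + 1 ≠ i := by omega
    rw [ih _ wi j hj (by simpa [mulSimple_val, n1, n2, n3] using aj),
      ih _ wj i hi (by
        simpa [mulSimple_val, n1.symm, n2.symm, n3.symm, show i ≠ j + 1 by omega] using ai),
      divDiff_comm hlt, mulSimple_comm w hi hj hlt]
  · obtain rfl : j = i + 1 := by omega
    have k1 : i + 1 + 1 ≠ i := by omega
    have k2 : i ≠ i + 1 + 1 := by omega
    have b1 : mulSimple w i hi ⟨i + 1, hi⟩ < mulSimple w i hi ⟨i + 1 + 1, hj⟩ := by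
      simpa [mulSimple_val, k1, k2] using ai.trans aj
    have v1 := weight_mulSimple_lt _ _ hj b1
    have c1 : mulSimple (mulSimple w i hi) (i + 1) hj ⟨i, Nat.lt_of_succ_lt hi⟩
        < mulSimple (mulSimple w i hi) (i + 1) hj ⟨i + 1, hi⟩ := by
      simpa [mulSimple_val, k1, k2] using aj
    have b2 : mulSimple w (i + 1) hj ⟨i, Nat.lt_of_succ_lt hi⟩
        < mulSimple w (i + 1) hj ⟨i + 1, hi⟩ := by
      simpa [mulSimple_val, k1, k2] using ai.trans aj
    have v2 := weight_mulSimple_lt _ _ hi b2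
    have c2 : mulSimple (mulSimple w (i + 1) hj) i hi ⟨i + 1, hi⟩
        < mulSimple (mulSimple w (i + 1) hj) i hi ⟨i + 1 + 1, hj⟩ := by
      simpa [mulSimple_val, k1, k2] using ai
    rw [ih _ wi _ hj b1, ih _ (v1.trans wi) _ hi c1, ih _ wj _ hi b2, ih _ (v2.trans wj) _ hj c2,
      divDiff_braid, mulSimple_braid]

/-- The defining recursion holds at every ascent. -/
theorem schubert_of_isAscent {n : ℕ} (w : Equiv.Perm (Fin n)) (i : ℕ) (hi : i + 1 < n)
    (h : w ⟨i, Nat.lt_of_succ_lt hi⟩ < w ⟨i + 1, hi⟩) :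
    schubert w = divDiff i (schubert (mulSimple w i hi)) := by
  classical
  have ex : ∃ i, IsAscent w i := ⟨i, hi, h⟩
  have unf : schubert w
      = divDiff (Nat.find ex) (schubert (mulSimple w (Nat.find ex) (Nat.find_spec ex).1)) := by
    rw [schubert, dif_pos ex]
  have ih : ∀ v : Equiv.Perm (Fin n), weight v < weight w → ∀ i (hi : i + 1 < n),
      v ⟨i, Nat.lt_of_succ_lt hi⟩ < v ⟨i + 1, hi⟩ →
        schubert v = divDiff i (schubert (mulSimple v i hi)) :=
    fun v hv i hi h => schubert_of_isAscent v i hi h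
  rw [unf]
  obtain ⟨hm, am⟩ := Nat.find_spec ex
  rcases lt_trichotomy (Nat.find ex) i with hlt | heq | hgt
  · exact divDiff_schubert_eq w ih hlt hm hi am h
  · congr!
  · exact (divDiff_schubert_eq w ih hgt hi hm h am).symm
termination_by weight w

/-- If `i` is an ascent of `w`, then `∂ᵢ` kills the Schubert polynomial of `w`. -/
theorem divDiff_schubert_of_isAscent {n : ℕ} (w : Equiv.Perm (Fin n)) (i : ℕ) (hi : i + 1 < n)
    (h : w ⟨i, Nat.lt_of_succ_lt hi⟩ < w ⟨i + 1, hi⟩) :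
    divDiff i (schubert w) = 0 := by
  rw [schubert_of_isAscent w i hi h, divDiff_divDiff_self]

/-- The Schubert polynomial of the longest element. -/
theorem schubert_revPerm (n : ℕ) :
    schubert (Fin.revPerm : Equiv.Perm (Fin n)) = ∏ j : Fin n, X (j : ℕ) ^ (n - 1 - (j : ℕ)) := by
  have : ¬ ∃ i, IsAscent (Fin.revPerm : Equiv.Perm (Fin n)) i := by
    rintro ⟨i, hi, h⟩
    simp only [Fin.revPerm_apply, Fin.lt_def, Fin.val_rev] at h
    omega
  rw [schubert, dif_neg this]

/-- The complete homogeneous symmetric polynomial of degree `j` in the first `i` variables. -/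
noncomputable def hPoly (i j : ℕ) : MvPolynomial ℕ ℤ :=
  rename (Fin.val : Fin i → ℕ) (hsymm (Fin i) ℤ j)

/-- The complete homogeneous monomial `h^1_{a₁} h^2_{a₂} ⋯`, where the entry `a i` is the degree of
the factor in `i + 1` variables, so `a 0` is `a₁`. -/
noncomputable def chm (a : ℕ →₀ ℕ) : MvPolynomial ℕ ℤ := a.prod fun i d => hPoly (i + 1) d

/-- The Lehmer code: `lehmer w i` is the number of `j > i` with `w j < w i`. -/
def lehmer {n : ℕ} (w : Equiv.Perm (Fin n)) (i : Fin n) : ℕ :=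
  (Finset.univ.filter fun j : Fin n => i < j ∧ w j < w i).card

/-- The Lehmer code, extended by zeros. -/
noncomputable def lehmerSeq {n : ℕ} (w : Equiv.Perm (Fin n)) : ℕ →₀ ℕ :=
  (Finsupp.equivFunOnFinite.symm (lehmer w)).embDomain Fin.valEmbedding

/-- `w` avoids the pattern with one-line notation `p`: no subsequence of the one-line notation of
`w` has the same relative order as `p`. -/
def Avoids {n k : ℕ} (w : Equiv.Perm (Fin n)) (p : Fin k → ℕ) : Prop :=
  ¬ ∃ f : Fin k → Fin n, StrictMono f ∧ ∀ a b, w (f a) < w (f b) ↔ p a < p b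

end Schubert

namespace Schubert

open MvPolynomial

/-! Indices start at `0`, and `e_i` is the point with `X i = 1` and all other variables `0`.
Avoiding 321 and 231 means that every entry has at most one larger entry to its left
(`AtMostOneLarger`).

Necessity: every complete homogeneous monomial takes the value 1 at `e_0`, so it suffices that
`𝔖_w(e_0) ≠ 0` forces avoidance. Evaluating the definition of `∂_i` gives `f(e_i) = f(e_{i+1}) +
(∂_i f)(e_{i+1})` (`eval_single_eq_add`). Hence if `𝔖_w(e_i) ≠ 0`, then `𝔖_w` or `∂_i 𝔖_w = 𝔖_{w
s_i}` is nonzero at `e_{i+1}`. Iterating up to `e_n`, where only `𝔖_id` survives, shows that `w`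
avoids both patterns (`atMostOneLarger_of_eval_ne_zero`).

Sufficiency: a polynomial is determined by its constant term and its divided differences
(`eq_of_divDiff_eq`), so induction on the length compares `∂_i` of both sides
(`schubert_eq_prod_hPoly`). For avoiding `w` the code vanishes at each ascent `i`, and at `i + 1`
for each descent `i`. Since `∂_i` turns `h^{i+1}_{d+1}` into `h^{i+2}_d` (`divDiff_hPoly_succ`) and
fixes the other factors, it moves the code of `w` to that of `w s_i` at a descent and kills the
product at an ascent. -/

/-! ### Divided differences: products, degrees, homogeneity. -/

theorem divDiff_eq_of_mul_eq {i : ℕ} {f g : MvPolynomial ℕ ℤ}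
    (h : (X i - X (i + 1)) * g = f - simpleAct i f) : divDiff i f = g :=
  mul_left_cancel₀ (X_sub_X_ne_zero (Nat.succ_ne_self i).symm) ((mul_divDiff i f).trans h.symm)

theorem divDiff_eq_zero_of_simpleAct_eq {i : ℕ} {f : MvPolynomial ℕ ℤ}
    (h : simpleAct i f = f) : divDiff i f = 0 :=
  divDiff_eq_of_mul_eq (by rw [h]; ring)

theorem divDiff_mul_of_simpleAct_eq {i : ℕ} (f : MvPolynomial ℕ ℤ) {g : MvPolynomial ℕ ℤ}
    (h : simpleAct i g = g) : divDiff i (f * g) = divDiff i f * g := by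
  apply divDiff_eq_of_mul_eq
  have e : simpleAct i (f * g) = simpleAct i f * g := by
    conv_rhs => rw [← h]
    simp only [simpleAct, map_mul]
  rw [e]
  linear_combination g * mul_divDiff i f

theorem divDiff_X (i : ℕ) : divDiff i (X i) = 1 :=
  divDiff_eq_of_mul_eq (by simp [simpleAct])

theorem degreeOf_simpleAct (i j : ℕ) (f : MvPolynomial ℕ ℤ) :
    degreeOf (Equiv.swap i (i + 1) j) (simpleAct i f) = degreeOf j f :=
  degreeOf_rename_of_injective (Equiv.injective _) j

theorem degreeOf_simpleAct_eq (i j : ℕ) (f : MvPolynomial ℕ ℤ) :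
    degreeOf j (simpleAct i f) = degreeOf (Equiv.swap i (i + 1) j) f := by
  rw [← degreeOf_simpleAct i (Equiv.swap i (i + 1) j) f, Equiv.swap_apply_self]

theorem simpleAct_eq_self_of_degreeOf {i : ℕ} {f : MvPolynomial ℕ ℤ}
    (h : degreeOf i f = 0) (h' : degreeOf (i + 1) f = 0) : simpleAct i f = f := by
  have := hom_congr_vars (p₁ := f) (p₂ := f)
    (f₁ := (rename (Equiv.swap i (i + 1)) : MvPolynomial ℕ ℤ →ₐ[ℤ] _).toRingHom)
    (f₂ := RingHom.id _) (RingHom.ext_int _ _) ?_ rfl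
  · exact this
  intro j hj _
  have hj := mem_vars_iff_degreeOf_ne_zero.mp hj
  have h1 : j ≠ i := by rintro rfl; exact hj h
  have h2 : j ≠ i + 1 := by rintro rfl; exact hj h'
  simp [Equiv.swap_apply_of_ne_of_ne h1 h2]

theorem degreeOf_divDiff_add_le (i j : ℕ) (f : MvPolynomial ℕ ℤ) (h : divDiff i f ≠ 0) :
    degreeOf j (X i - X (i + 1) : MvPolynomial ℕ ℤ) + degreeOf j (divDiff i f)
      ≤ max (degreeOf j f) (degreeOf (Equiv.swap i (i + 1) j) f) := by
  rw [← degreeOf_mul_eq (X_sub_X_ne_zero (Nat.succ_ne_self i).symm) h, mul_divDiff,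
    ← degreeOf_simpleAct_eq]
  exact degreeOf_sub_le _ _ _

theorem one_le_degreeOf_X_sub_X {i j k : ℕ} (h : i ≠ j) (hk : k = i ∨ k = j) :
    1 ≤ degreeOf k (X i - X j : MvPolynomial ℕ ℤ) := by
  have key : ∀ a b : ℕ, a ≠ b → 1 ≤ degreeOf a (X a - X b : MvPolynomial ℕ ℤ) := by
    -- Write `X a` as `(X a - X b) - (-X b)`: its degree 1 in `X a` must come from the first term.
    intro a b hab
    have := degreeOf_sub_le a (X a - X b : MvPolynomial ℕ ℤ) (-X b)
    rw [sub_neg_eq_add, sub_add_cancel, degreeOf_neg, degreeOf_X_self, degreeOf_X_of_ne hab] at this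
    simpa using this
  rcases hk with rfl | rfl
  · exact key _ _ h
  · rw [← degreeOf_neg, neg_sub]
    exact key _ _ h.symm

/-- Polynomials in the span of the monomials that divide the staircase monomial are stable under
divided differences. -/
theorem degreeOf_divDiff_le_staircase {n : ℕ} {f : MvPolynomial ℕ ℤ}
    (hf : ∀ j, degreeOf j f ≤ n - 1 - j) (i j : ℕ) : degreeOf j (divDiff i f) ≤ n - 1 - j := by
  by_cases h : divDiff i f = 0
  · simp [h]
  have key := degreeOf_divDiff_add_le i j f h
  -- In both exchanged variables `f` has degree at most `n - 1 - i`. The factor `X i - X (i + 1)`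
  -- takes up one, which leaves the smaller bound, that of `X (i + 1)`, for both.
  by_cases hj : j = i ∨ j = i + 1
  · have h1 := one_le_degreeOf_X_sub_X (Nat.ne_add_one i) hj
    have hi := hf i
    have hi' := hf (i + 1)
    rcases hj with rfl | rfl
    · rw [Equiv.swap_apply_left] at key
      omega
    · rw [Equiv.swap_apply_right] at key
      omega
  · push Not at hj
    rw [Equiv.swap_apply_of_ne_of_ne hj.1 hj.2, max_self] at key
    have := hf j
    omega

/-- Multiplication by `p` shifts homogeneous components by `a`, so a component of `q` outside degree
`b` would survive in the product. -/
theorem isHomogeneous_of_mul {p q : MvPolynomial ℕ ℤ} {a b : ℕ} (hp : p.IsHomogeneous a)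
    (h0 : p ≠ 0) (h : (p * q).IsHomogeneous (a + b)) : q.IsHomogeneous b := by
  have hsum : ∀ k, homogeneousComponent (a + k) (p * q) = p * homogeneousComponent k q := by
    intro k
    let := MvPolynomial.gradedAlgebra (σ := ℕ) (R := ℤ)
    have := DirectSum.coe_decompose_mul_add_of_left_mem (homogeneousSubmodule ℕ ℤ)
      (i := a) (j := k) (a := p) (b := q) hp
    rw [← decomposition.decompose'_apply, ← decomposition.decompose'_apply]
    exact this
  have hz : ∀ k, k ≠ b → homogeneousComponent k q = 0 := by
    intro k hk
    have := hsum k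
    rw [homogeneousComponent_of_mem h, if_neg (by omega)] at this
    exact (mul_eq_zero.mp this.symm).resolve_left h0
  rw [← sum_homogeneousComponent q]
  refine IsHomogeneous.sum _ _ _ fun k _ => ?_
  by_cases hk : k = b
  · subst hk
    exact homogeneousComponent_isHomogeneous _ _
  · rw [hz k hk]
    exact isHomogeneous_zero _ _ _

theorem isHomogeneous_divDiff {i d : ℕ} {f : MvPolynomial ℕ ℤ} (hf : f.IsHomogeneous (d + 1)) :
    (divDiff i f).IsHomogeneous d := by
  refine isHomogeneous_of_mul (p := X i - X (i + 1)) (a := 1)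
    ((isHomogeneous_X _ _).sub (isHomogeneous_X _ _))
    (X_sub_X_ne_zero (Nat.succ_ne_self i).symm) ?_
  rw [mul_divDiff, add_comm 1 d]
  exact hf.sub hf.rename_isHomogeneous

theorem constantCoeff_eq_zero_of_isHomogeneous {d : ℕ} {f : MvPolynomial ℕ ℤ}
    (hf : f.IsHomogeneous d) (hd : d ≠ 0) : constantCoeff f = 0 :=
  hf.coeff_eq_zero (by simpa using hd.symm)

/-- A polynomial is determined by its divided differences and its constant coefficient. -/
theorem eq_of_divDiff_eq {f g : MvPolynomial ℕ ℤ} (h : ∀ i, divDiff i f = divDiff i g)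
    (h0 : constantCoeff f = constantCoeff g) : f = g := by
  have hs : ∀ i, simpleAct i (f - g) = f - g := by
    intro i
    have e : simpleAct i (f - g) = simpleAct i f - simpleAct i g := by
      simp only [simpleAct, map_sub]
    rw [e]
    have hf := mul_divDiff i f
    rw [h i] at hf
    linear_combination hf - mul_divDiff i g
  -- The difference is invariant under all simple transpositions, so it has the same degree in every
  -- variable. Infinitely many variables do not occur in it, so none does.
  have hdeg : ∀ i, degreeOf i (f - g) = degreeOf 0 (f - g) := by
    intro i
    induction i with
    | zero => rfl
    | succ i ih =>
      rw [← ih, ← degreeOf_simpleAct i i (f - g), hs, Equiv.swap_apply_left]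
  obtain ⟨k, hk⟩ := Infinite.exists_notMem_finset (f - g).vars
  have hk : degreeOf k (f - g) = 0 := by
    by_contra hne
    exact hk (mem_vars_iff_degreeOf_ne_zero.mpr hne)
  have hv : (f - g).vars = ∅ := by
    refine Finset.eq_empty_of_forall_notMem fun i hi => ?_
    rw [mem_vars_iff_degreeOf_ne_zero, hdeg i, ← hdeg k] at hi
    exact hi hk
  rw [vars_eq_empty_iff_eq_C] at hv
  have hc : coeff 0 (f - g) = 0 := by
    rw [← constantCoeff_eq, map_sub, h0, sub_self]
  rw [hc, C_0] at hv
  exact sub_eq_zero.mp hv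

/-! ### Evaluation at coordinate vectors. -/

theorem eval_single_eq_add (i : ℕ) (f : MvPolynomial ℕ ℤ) :
    eval (Pi.single i 1 : ℕ → ℤ) f = eval (Pi.single (i + 1) 1 : ℕ → ℤ) f
      + eval (Pi.single (i + 1) 1 : ℕ → ℤ) (divDiff i f) := by
  have h := congrArg (eval (Pi.single (i + 1) 1 : ℕ → ℤ)) (mul_divDiff i f)
  have e : eval (Pi.single (i + 1) 1 : ℕ → ℤ) (simpleAct i f)
      = eval (Pi.single i 1 : ℕ → ℤ) f := by
    rw [simpleAct, eval_rename]
    congr 2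
    funext x
    simp only [Function.comp, Pi.single_apply, Equiv.swap_apply_def]
    grind
  simp only [map_mul, map_sub, eval_X, e] at h
  simp only [Pi.single_eq_same, Pi.single_apply, Nat.left_eq_add, one_ne_zero, if_false] at h
  linarith

theorem eval_eq_constantCoeff {f : MvPolynomial ℕ ℤ} {x : ℕ → ℤ}
    (h : ∀ j ∈ f.vars, x j = 0) : eval x f = constantCoeff f :=
  hom_congr_vars (RingHom.ext_int _ _) (fun j hj _ => by simp [h j hj]) rfl

/-! ### Complete homogeneous symmetric polynomials -/

/-- A multiset of size `d + 1` either avoids `none` or arises by adding `none` to one of size `d`.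
-/
theorem hsymm_option_succ (τ : Type*) [Fintype τ] [DecidableEq τ] (d : ℕ) :
    hsymm (Option τ) ℤ (d + 1)
      = rename some (hsymm τ ℤ (d + 1)) + X none * hsymm (Option τ) ℤ d := by
  unfold hsymm
  rw [← Equiv.sum_comp (symOptionSuccEquiv (α := τ) (n := d)).symm, Fintype.sum_sum_type, add_comm,
    Finset.mul_sum, map_sum]
  congr 1
  · refine Finset.sum_congr rfl fun s _ => ?_
    simp [symOptionSuccEquiv, SymOptionSuccEquiv.decode, ← Multiset.prod_hom']
  · refine Finset.sum_congr rfl fun s _ => ?_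
    simp [symOptionSuccEquiv, SymOptionSuccEquiv.decode, Sym.coe_cons]

@[simp]
theorem hPoly_zero_right (k : ℕ) : hPoly k 0 = 1 := by simp [hPoly]

@[simp]
theorem hPoly_zero_succ (d : ℕ) : hPoly 0 (d + 1) = 0 := by simp [hPoly, hsymm]

theorem hPoly_succ_succ (k d : ℕ) :
    hPoly (k + 1) (d + 1) = hPoly k (d + 1) + X k * hPoly (k + 1) d := by
  have e : ∀ m, hPoly (k + 1) m
      = rename (Fin.val ∘ finSuccEquivLast.symm) (hsymm (Option (Fin k)) ℤ m) := by
    intro m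
    rw [hPoly, ← rename_hsymm (Option (Fin k)) ℤ m finSuccEquivLast.symm, rename_rename]
  rw [e, e, hsymm_option_succ, map_add, map_mul, rename_rename, rename_X, hPoly]
  congr 2
  · congr 1
    funext x
    simp

theorem simpleAct_hPoly {i k : ℕ} (h : i + 1 ≠ k) (d : ℕ) :
    simpleAct i (hPoly k d) = hPoly k d := by
  unfold simpleAct hPoly
  rw [rename_rename]
  rcases Nat.lt_or_ge (i + 1) k with hk | hk
  · rw [← hsymm_isSymmetric (Fin k) ℤ d
      (Equiv.swap ⟨i, by omega⟩ ⟨i + 1, hk⟩), rename_rename, hsymm_isSymmetric]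
    congr 1
    congr 1
    funext x
    simp only [Function.comp, Equiv.swap_apply_def, Fin.ext_iff]
    split_ifs <;> simp_all
  · congr 1
    congr 1
    funext x
    have := x.2
    simp only [Function.comp]
    exact Equiv.swap_apply_of_ne_of_ne (by omega) (by omega)

/-- Split off the last variable of `hPoly (i + 2) (d + 1)` and subtract the image of this identity
under `s_i`. The polynomials in `i + 2` variables are invariant, so the left-hand sides cancel. -/
theorem divDiff_hPoly_succ (i d : ℕ) :
    divDiff i (hPoly (i + 1) (d + 1)) = hPoly (i + 2) d := by
  apply divDiff_eq_of_mul_eq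
  have h := hPoly_succ_succ (i + 1) d
  have h' := congrArg (simpleAct i) h
  have e : simpleAct i (hPoly (i + 1) (d + 1) + X (i + 1) * hPoly (i + 1 + 1) d)
      = simpleAct i (hPoly (i + 1) (d + 1)) + X i * simpleAct i (hPoly (i + 1 + 1) d) := by
    simp [simpleAct]
  have e' : simpleAct i (hPoly (i + 1 + 1) d) = hPoly (i + 1 + 1) d := simpleAct_hPoly (by omega) d
  rw [e, e', simpleAct_hPoly (by omega)] at h'
  linear_combination h - h'

theorem constantCoeff_hPoly_succ (k d : ℕ) : constantCoeff (hPoly k (d + 1)) = 0 := by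
  induction k with
  | zero => simp
  | succ k ih => simp [hPoly_succ_succ, ih]

/-- Only the power of `X 0`, with coefficient 1, survives. -/
theorem eval_single_zero_hPoly (k d : ℕ) :
    eval (Pi.single 0 1 : ℕ → ℤ) (hPoly (k + 1) d) = 1 := by
  induction k with
  | zero =>
    induction d with
    | zero => simp
    | succ d ih => simp [hPoly_succ_succ, ih]
  | succ k ih =>
    cases d with
    | zero => simp
    | succ d => simp [hPoly_succ_succ (k + 1), ih]

theorem eval_single_zero_chm (a : ℕ →₀ ℕ) : eval (Pi.single 0 1 : ℕ → ℤ) (chm a) = 1 := by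
  simp [chm, Finsupp.prod, map_prod, eval_single_zero_hPoly]

theorem chm_lehmerSeq {n : ℕ} (w : Equiv.Perm (Fin n)) :
    chm (lehmerSeq w) = ∏ i : Fin n, hPoly ((i : ℕ) + 1) (lehmer w i) := by
  rw [chm, lehmerSeq, Finsupp.prod_embDomain, Finsupp.prod_fintype _ _ (by simp)]
  rfl

/-! ### Steps in the weak order. -/

theorem schubert_eq_prod_of_forall_not_isAscent {n : ℕ} {w : Equiv.Perm (Fin n)}
    (h : ∀ i, ¬ IsAscent w i) : schubert w = ∏ j : Fin n, X (j : ℕ) ^ (n - 1 - (j : ℕ)) := by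
  rw [schubert, dif_neg (by simpa using h)]

/-- Induction along the recursion that defines Schubert polynomials, at the first ascents. -/
theorem weak_order_induction {n : ℕ} {P : Equiv.Perm (Fin n) → Prop}
    (top : ∀ w, (∀ i, ¬ IsAscent w i) → P w)
    (step : ∀ w i (hi : i + 1 < n), w ⟨i, Nat.lt_of_succ_lt hi⟩ < w ⟨i + 1, hi⟩ →
      (∀ j < i, ¬ IsAscent w j) → P (mulSimple w i hi) → P w) (w : Equiv.Perm (Fin n)) : P w := by
  classical
  induction hm : weight w using Nat.strong_induction_on generalizing w with
  | _ m ih =>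
    by_cases ex : ∃ i, IsAscent w i
    · obtain ⟨hi, h⟩ := Nat.find_spec ex
      exact step w _ hi h (fun j hj => Nat.find_min ex hj)
        (ih _ (hm ▸ weight_mulSimple_lt w _ hi h) _ rfl)
    · exact top w (by simpa using ex)

theorem mulSimple_mulSimple {n : ℕ} (w : Equiv.Perm (Fin n)) (i : ℕ) (hi : i + 1 < n) :
    mulSimple (mulSimple w i hi) i hi = w := by
  simp [mulSimple, mul_assoc]

theorem mulSimple_left {n : ℕ} (w : Equiv.Perm (Fin n)) (i : ℕ) (hi : i + 1 < n) :
    mulSimple w i hi ⟨i, Nat.lt_of_succ_lt hi⟩ = w ⟨i + 1, hi⟩ := by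
  simp [mulSimple]

theorem mulSimple_right {n : ℕ} (w : Equiv.Perm (Fin n)) (i : ℕ) (hi : i + 1 < n) :
    mulSimple w i hi ⟨i + 1, hi⟩ = w ⟨i, Nat.lt_of_succ_lt hi⟩ := by
  simp [mulSimple]

theorem mulSimple_of_ne {n : ℕ} (w : Equiv.Perm (Fin n)) (i : ℕ) (hi : i + 1 < n) {p : Fin n}
    (h : (p : ℕ) ≠ i) (h' : (p : ℕ) ≠ i + 1) : mulSimple w i hi p = w p := by
  simp [mulSimple_val, h, h']

theorem divDiff_schubert_of_descent {n : ℕ} (w : Equiv.Perm (Fin n)) (i : ℕ) (hi : i + 1 < n)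
    (h : w ⟨i + 1, hi⟩ < w ⟨i, Nat.lt_of_succ_lt hi⟩) :
    divDiff i (schubert w) = schubert (mulSimple w i hi) := by
  rw [schubert_of_isAscent (mulSimple w i hi) i hi (by rwa [mulSimple_left, mulSimple_right]),
    mulSimple_mulSimple]

/-! ### The Lehmer code -/

/-- Code entries travel with the values of `w`. The larger of the two exchanged values now precedes
the smaller one and gains one inversion. -/
theorem lehmer_mulSimple {n : ℕ} (w : Equiv.Perm (Fin n)) (i : ℕ) (hi : i + 1 < n)
    (h : w ⟨i, Nat.lt_of_succ_lt hi⟩ < w ⟨i + 1, hi⟩) (p : Fin n) :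
    lehmer (mulSimple w i hi) (Equiv.swap ⟨i, Nat.lt_of_succ_lt hi⟩ ⟨i + 1, hi⟩ p)
      = lehmer w p + if p = ⟨i + 1, hi⟩ then 1 else 0 := by
  set a : Fin n := ⟨i, Nat.lt_of_succ_lt hi⟩ with ha
  set b : Fin n := ⟨i + 1, hi⟩ with hb
  have e : lehmer (mulSimple w i hi) (Equiv.swap a b p)
      = (Finset.univ.filter fun j => Equiv.swap a b p < Equiv.swap a b j ∧ w j < w p).card := by
    unfold lehmer
    refine Finset.card_equiv (Equiv.swap a b) fun j => ?_
    simp [mulSimple, ← ha, ← hb]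
  rw [e]
  unfold lehmer
  -- Exchanging adjacent positions preserves the order of every pair of positions except the
  -- exchanged pair.
  have hlt : ∀ x y : Fin n, x ≠ a ∨ y ≠ b → x ≠ b ∨ y ≠ a →
      (Equiv.swap a b x < Equiv.swap a b y ↔ x < y) := by
    intro x y h1 h2
    simp only [Equiv.swap_apply_def]
    simp only [ha, hb, Fin.lt_def, Fin.ext_iff, ne_eq] at *
    split_ifs <;> simp_all <;> omega
  split_ifs with hp
  · subst hp
    rw [← Finset.card_insert_of_notMem (a := a)]
    · congr 1
      ext j
      simp only [Finset.mem_filter, Finset.mem_univ, true_and, Finset.mem_insert]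
      by_cases hj : j = a
      · subst hj
        simp only [Equiv.swap_apply_left, Equiv.swap_apply_right, h, and_true, true_or, iff_true]
        simp [ha, hb]
      · rw [hlt _ _ (Or.inl (by simp [ha, hb])) (Or.inr hj)]
        simp [hj]
    · simp [ha, hb]
  · rw [add_zero]
    congr 1
    ext j
    simp only [Finset.mem_filter, Finset.mem_univ, true_and]
    by_cases hpj : p = a ∧ j = b
    · obtain ⟨rfl, rfl⟩ := hpj
      simp [h.le]
    · rw [hlt _ _ (by tauto) (Or.inl hp)]

theorem sum_lehmer_mulSimple {n : ℕ} (w : Equiv.Perm (Fin n)) (i : ℕ) (hi : i + 1 < n)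
    (h : w ⟨i, Nat.lt_of_succ_lt hi⟩ < w ⟨i + 1, hi⟩) :
    ∑ p, lehmer (mulSimple w i hi) p = ∑ p, lehmer w p + 1 := by
  rw [← Equiv.sum_comp (Equiv.swap ⟨i, Nat.lt_of_succ_lt hi⟩ ⟨i + 1, hi⟩)]
  simp [lehmer_mulSimple w i hi h, Finset.sum_add_distrib]

theorem lehmer_le_of_lt {n : ℕ} (w : Equiv.Perm (Fin n)) (i : ℕ) (hi : i + 1 < n)
    (h : w ⟨i, Nat.lt_of_succ_lt hi⟩ < w ⟨i + 1, hi⟩) :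
    lehmer w ⟨i, Nat.lt_of_succ_lt hi⟩ ≤ lehmer w ⟨i + 1, hi⟩ := by
  refine Finset.card_le_card fun j hj => ?_
  simp only [Finset.mem_filter, Finset.mem_univ, true_and, Fin.lt_def] at hj h ⊢
  have hne : (j : ℕ) ≠ i + 1 := by
    rintro hj'
    obtain rfl : j = ⟨i + 1, hi⟩ := Fin.ext hj'
    omega
  omega

theorem lehmer_lt_of_gt {n : ℕ} (w : Equiv.Perm (Fin n)) (i : ℕ) (hi : i + 1 < n)
    (h : w ⟨i + 1, hi⟩ < w ⟨i, Nat.lt_of_succ_lt hi⟩) :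
    lehmer w ⟨i + 1, hi⟩ < lehmer w ⟨i, Nat.lt_of_succ_lt hi⟩ := by
  refine Finset.card_lt_card (Finset.ssubset_iff_of_subset ?_ |>.mpr ⟨⟨i + 1, hi⟩, ?_⟩)
  · intro j hj
    simp only [Finset.mem_filter, Finset.mem_univ, true_and, Fin.lt_def] at hj h ⊢
    omega
  · simp [h]

theorem descent_of_not_isAscent {n : ℕ} {w : Equiv.Perm (Fin n)} {i : ℕ} (h : ¬ IsAscent w i)
    (hi : i + 1 < n) : w ⟨i + 1, hi⟩ < w ⟨i, Nat.lt_of_succ_lt hi⟩ := by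
  refine lt_of_le_of_ne (not_lt.mp fun h' => h ⟨hi, h'⟩) fun e => ?_
  have := w.injective e
  simp at this

theorem lehmer_of_forall_not_isAscent {n : ℕ} {w : Equiv.Perm (Fin n)}
    (h : ∀ i, ¬ IsAscent w i) (j : Fin n) : lehmer w j = n - 1 - j := by
  have anti : ∀ (d i : ℕ) (hd : i + d + 1 < n), w ⟨i + d + 1, hd⟩ < w ⟨i, by omega⟩ := by
    intro d
    induction d with
    | zero => exact fun i hd => descent_of_not_isAscent (h i) hd
    | succ d ih =>
      exact fun i hd => (descent_of_not_isAscent (h (i + d + 1)) hd).trans (ih i (by omega))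
  rw [lehmer, ← Fin.card_Ioi]
  congr 1
  ext k
  simp only [Finset.mem_filter, Finset.mem_univ, true_and, Finset.mem_Ioi, and_iff_left_iff_imp]
  intro hk
  obtain ⟨d, hd⟩ := Nat.exists_eq_add_of_lt (show (j : ℕ) < k from hk)
  have := anti d j (hd ▸ k.2)
  convert this

theorem eq_one_of_lehmer_eq_zero {n : ℕ} {w : Equiv.Perm (Fin n)} (h : ∀ p, lehmer w p = 0) :
    w = 1 := by
  have hw : StrictMono w := by
    intro x y hxy
    have := h x
    simp only [lehmer, Finset.card_eq_zero, Finset.filter_eq_empty_iff, Finset.mem_univ,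
      true_implies, not_and, not_lt] at this
    exact lt_of_le_of_ne (this hxy) (w.injective.ne hxy.ne)
  have hw' : StrictMono w.symm := fun x y hxy => by
    rw [← hw.lt_iff_lt]
    simpa using hxy
  ext x
  have h1 : w x ≤ x := by simpa using hw'.le_apply (x := w x)
  exact congrArg Fin.val (le_antisymm h1 hw.le_apply)

/-! ### General properties of Schubert polynomials -/

theorem isHomogeneous_schubert {n : ℕ} (w : Equiv.Perm (Fin n)) :
    (schubert w).IsHomogeneous (∑ p, lehmer w p) := by
  induction w using weak_order_induction with
  | top w h =>
    rw [schubert_eq_prod_of_forall_not_isAscent h]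
    simp only [lehmer_of_forall_not_isAscent h]
    exact IsHomogeneous.prod _ _ _ fun j _ => isHomogeneous_X_pow _ _
  | step w i hi h _ ih =>
    rw [schubert_of_isAscent w i hi h]
    rw [sum_lehmer_mulSimple w i hi h] at ih
    exact isHomogeneous_divDiff ih

theorem degreeOf_schubert_le {n : ℕ} (w : Equiv.Perm (Fin n)) (j : ℕ) :
    degreeOf j (schubert w) ≤ n - 1 - j := by
  induction w using weak_order_induction generalizing j with
  | top w h =>
    rw [schubert_eq_prod_of_forall_not_isAscent h]
    refine (degreeOf_prod_le _ _ _).trans ?_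
    by_cases hj : j < n
    · rw [Finset.sum_eq_single ⟨j, hj⟩]
      · simp
      · intro b _ hb
        exact degreeOf_X_pow_of_ne _ fun e => hb (Fin.ext e.symm)
      · simp
    · rw [Finset.sum_eq_zero]
      · simp
      · intro b _
        exact degreeOf_X_pow_of_ne _ (by omega)
  | step w i hi h _ ih =>
    rw [schubert_of_isAscent w i hi h]
    exact degreeOf_divDiff_le_staircase ih i j

/-- The staircase bound is `0` from index `n - 1` on, so neither exchanged variable occurs. -/
theorem divDiff_schubert_of_le {n : ℕ} (w : Equiv.Perm (Fin n)) {i : ℕ} (hi : n ≤ i + 1) :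
    divDiff i (schubert w) = 0 := by
  have h1 := degreeOf_schubert_le w i
  have h2 := degreeOf_schubert_le w (i + 1)
  exact divDiff_eq_zero_of_simpleAct_eq (simpleAct_eq_self_of_degreeOf (by omega) (by omega))

theorem simpleAct_prod_X_pow {n : ℕ} (c : Fin n → ℕ) (i : ℕ) (hi : i + 1 < n)
    (h : c ⟨i, Nat.lt_of_succ_lt hi⟩ = c ⟨i + 1, hi⟩) :
    simpleAct i (∏ p : Fin n, X (p : ℕ) ^ c p) = ∏ p : Fin n, X (p : ℕ) ^ c p := by
  rw [← Equiv.prod_comp (Equiv.swap ⟨i, Nat.lt_of_succ_lt hi⟩ ⟨i + 1, hi⟩)]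
  simp only [simpleAct, map_prod, map_pow, rename_X]
  refine (Equiv.prod_comp (Equiv.swap ⟨i, Nat.lt_of_succ_lt hi⟩ ⟨i + 1, hi⟩) _).symm.trans ?_
  simp only [Equiv.swap_apply_self]
  refine Finset.prod_congr rfl fun p _ => ?_
  simp only [Equiv.swap_apply_def, Fin.ext_iff]
  grind

/-- The Schubert polynomial of a dominant permutation is a monomial. -/
theorem schubert_of_antitone_lehmer {n : ℕ} (w : Equiv.Perm (Fin n)) (hw : Antitone (lehmer w)) :
    schubert w = ∏ p : Fin n, X (p : ℕ) ^ lehmer w p := by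
  induction w using weak_order_induction with
  | top w h =>
    rw [schubert_eq_prod_of_forall_not_isAscent h]
    simp only [lehmer_of_forall_not_isAscent h]
  | step w i hi h hfirst ih =>
    set a : Fin n := ⟨i, Nat.lt_of_succ_lt hi⟩ with ha
    set b : Fin n := ⟨i + 1, hi⟩ with hb
    have hab : lehmer w a = lehmer w b :=
      le_antisymm (lehmer_le_of_lt w i hi h) (hw (by simp [ha, hb, Fin.le_def]))
    -- As the code agrees at `a` and `b`, the exchange of code entries is invisible and only the new
    -- inversion remains.
    have hv : ∀ p, lehmer (mulSimple w i hi) p = lehmer w p + if p = a then 1 else 0 := by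
      intro p
      have := lehmer_mulSimple w i hi h (Equiv.swap a b p)
      rw [Equiv.swap_apply_self] at this
      rw [this]
      refine congrArg₂ (· + ·) ?_ (if_congr ?_ rfl rfl)
      swap
      · rw [← Equiv.eq_symm_apply, Equiv.symm_swap, ← hb, Equiv.swap_apply_right]
      rw [Equiv.swap_apply_def]
      split_ifs with h1 h2
      · rw [h1, hab]
      · rw [h2, hab]
      · rfl
    have hanti : Antitone (lehmer (mulSimple w i hi)) := by
      intro p q hpq
      rw [hv, hv]
      have h1 := hw hpq
      by_cases hq : q = a
      · by_cases hp : p = a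
        · simp [hp, hq]
        · have hlt : (p : ℕ) < i := by
            have h2 : (p : ℕ) ≤ q := hpq
            have h3 : (p : ℕ) ≠ i := fun e => hp (Fin.ext e)
            have h4 : (q : ℕ) = i := by rw [hq]
            omega
          -- Since `i` is the first ascent, the position before it is a descent. The code drops
          -- strictly there, which leaves room for the extra one at `a`.
          obtain ⟨m, rfl⟩ : ∃ m, i = m + 1 := ⟨i - 1, by omega⟩
          have h5 := lehmer_lt_of_gt w m (by omega) (descent_of_not_isAscent
            (hfirst m (by omega)) (by omega))
          have h6 : lehmer w ⟨m, by omega⟩ ≤ lehmer w p := hw (by simp [Fin.le_def]; omega)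
          rw [if_neg hp, if_pos hq, hq]
          exact Nat.succ_le_of_lt (h5.trans_le h6)
      · rw [if_neg hq]
        exact h1.trans (Nat.le_add_right _ _)
    rw [schubert_of_isAscent w i hi h, ih hanti]
    have e : ∏ p : Fin n, (X (p : ℕ) : MvPolynomial ℕ ℤ) ^ lehmer (mulSimple w i hi) p
        = X i * ∏ p : Fin n, X (p : ℕ) ^ lehmer w p := by
      simp only [hv, pow_add, Finset.prod_mul_distrib]
      rw [mul_comm]
      congr 1
      rw [Finset.prod_eq_single a]
      · simp [ha]
      · intro p _ hp
        simp [hp]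
      · simp
    rw [e, divDiff_mul_of_simpleAct_eq _ (simpleAct_prod_X_pow _ i hi hab), divDiff_X, one_mul]

/-- The base case for the identity. The recursion reaches it from the longest element, and along
first ascents the whole chain consists of dominant permutations, which is why those are treated
first. -/
theorem schubert_eq_one_of_lehmer_eq_zero {n : ℕ} {w : Equiv.Perm (Fin n)}
    (h : ∀ p, lehmer w p = 0) : schubert w = 1 := by
  rw [schubert_of_antitone_lehmer w (fun p q _ => by rw [h, h])]
  simp [h]

/-! ### Pattern avoidance -/

/-- Every entry in the one-line notation of `w` has at most one larger entry to its left. -/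
def AtMostOneLarger {n : ℕ} (w : Equiv.Perm (Fin n)) : Prop :=
  ∀ ⦃a b k : Fin n⦄, a < k → b < k → w k < w a → w k < w b → a = b

theorem strictMono_vecCons₃ {n : ℕ} {a b k : Fin n} (h : a < b) (h' : b < k) :
    StrictMono ![a, b, k] := by
  rw [Fin.strictMono_iff_lt_succ]
  intro i
  fin_cases i
  · exact h
  · exact h'

/-- Both patterns end in their smallest letter, and their first two letters exhaust the possible
orders of two larger entries. -/
theorem avoids_iff_atMostOneLarger {n : ℕ} (w : Equiv.Perm (Fin n)) :
    Avoids w ![3, 2, 1] ∧ Avoids w ![2, 3, 1] ↔ AtMostOneLarger w := by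
  constructor
  · rintro ⟨h1, h2⟩ a b k hak hbk ha hb
    by_contra hne
    wlog hab : a < b generalizing a b
    · exact this hbk hak hb ha (Ne.symm hne) (lt_of_le_of_ne (not_lt.mp hab) (Ne.symm hne))
    rcases lt_or_gt_of_ne (w.injective.ne hne) with hw | hw
    · refine h2 ⟨![a, b, k], strictMono_vecCons₃ hab hbk, fun x y => ?_⟩
      fin_cases x <;> fin_cases y <;> simp [hw, ha, hb, hw.le, ha.le, hb.le]
    · refine h1 ⟨![a, b, k], strictMono_vecCons₃ hab hbk, fun x y => ?_⟩
      fin_cases x <;> fin_cases y <;> simp [hw, ha, hb, hw.le, ha.le, hb.le]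
  · intro h
    constructor
    · rintro ⟨f, hf, hw⟩
      have := h (hf (show (0 : Fin 3) < 2 by decide)) (hf (show (1 : Fin 3) < 2 by decide))
        ((hw 2 0).mpr (by decide)) ((hw 2 1).mpr (by decide))
      exact absurd (hf.injective this) (by decide)
    · rintro ⟨f, hf, hw⟩
      have := h (hf (show (0 : Fin 3) < 2 by decide)) (hf (show (1 : Fin 3) < 2 by decide))
        ((hw 2 0).mpr (by decide)) ((hw 2 1).mpr (by decide))
      exact absurd (hf.injective this) (by decide)

/-- Removing a descent creates no inversion: the swap carries each inversion of `w s_i` to one of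
`w`. -/
theorem AtMostOneLarger.mulSimple {n : ℕ} {w : Equiv.Perm (Fin n)} (hw : AtMostOneLarger w)
    (i : ℕ) (hi : i + 1 < n) (h : w ⟨i + 1, hi⟩ < w ⟨i, Nat.lt_of_succ_lt hi⟩) :
    AtMostOneLarger (mulSimple w i hi) := by
  set p : Fin n := ⟨i, Nat.lt_of_succ_lt hi⟩ with hp
  set q : Fin n := ⟨i + 1, hi⟩ with hq
  have key : ∀ x y : Fin n, x < y → w (Equiv.swap p q y) < w (Equiv.swap p q x) →
      Equiv.swap p q x < Equiv.swap p q y := by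
    intro x y hxy hlt
    by_cases hx : x = p ∧ y = q
    · obtain ⟨rfl, rfl⟩ := hx
      rw [Equiv.swap_apply_left, Equiv.swap_apply_right] at hlt
      exact absurd hlt h.not_gt
    · simp only [Equiv.swap_apply_def]
      simp only [hp, hq, Fin.lt_def, Fin.ext_iff] at *
      split_ifs <;> simp_all <;> omega
  intro a b k hak hbk ha hb
  exact (Equiv.swap p q).injective (hw (key a k hak ha) (key b k hbk hb) ha hb)

/-- As `w s_i` fixes all positions up to `i`, the value `i` stands at position `i + 1` of `w`, and
only position `i` to its left can hold a larger value. Position `i` itself follows only smaller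
fixed values, and entries after `i + 1` see the same values to their left as before. -/
theorem AtMostOneLarger.of_mulSimple {n : ℕ} {w : Equiv.Perm (Fin n)} (i : ℕ) (hi : i + 1 < n)
    (hv : AtMostOneLarger (Schubert.mulSimple w i hi))
    (hfix : ∀ j : Fin n, (j : ℕ) < i + 1 → Schubert.mulSimple w i hi j = j) :
    AtMostOneLarger w := by
  have hlow : ∀ j : Fin n, (j : ℕ) < i → w j = j := by
    intro j hj
    rw [← mulSimple_of_ne w i hi (by omega) (by omega)]
    exact hfix j (by omega)
  have hright : w ⟨i + 1, hi⟩ = ⟨i, Nat.lt_of_succ_lt hi⟩ := by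
    rw [← mulSimple_left w i hi]
    exact hfix _ (Nat.lt_succ_self i)
  have hge : ∀ j : Fin n, i ≤ j → i ≤ (w j : ℕ) := by
    intro j hj
    by_contra hlt
    push Not at hlt
    have := w.injective (hlow (w j) hlt)
    rw [this] at hlt
    omega
  intro a b k hak hbk ha hb
  simp only [Fin.lt_def] at hak hbk ha hb
  rcases Nat.lt_trichotomy k i with hk | hk | hk
  · rw [hlow k hk, hlow a (by omega)] at ha
    omega
  · have := hge k hk.ge
    rw [hlow a (by omega)] at ha
    omega
  rcases eq_or_ne (k : ℕ) (i + 1) with hk' | hk'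
  · obtain rfl : k = ⟨i + 1, hi⟩ := Fin.ext hk'
    rw [hright] at ha hb
    have h1 : ¬ (a : ℕ) < i := fun h => by
      rw [hlow a h] at ha
      exact absurd ha (by simp; omega)
    have h2 : ¬ (b : ℕ) < i := fun h => by
      rw [hlow b h] at hb
      exact absurd hb (by simp; omega)
    ext
    simp only at hak hbk
    omega
  · have hswap : ∀ x : Fin n, x < k →
        Equiv.swap ⟨i, Nat.lt_of_succ_lt hi⟩ ⟨i + 1, hi⟩ x < k := by
      intro x hx
      simp only [Equiv.swap_apply_def, Fin.lt_def] at *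
      split_ifs <;> simp <;> omega
    have hvk := mulSimple_of_ne w i hi (p := k) (by omega) hk'
    have hvs : ∀ x, Schubert.mulSimple w i hi
        (Equiv.swap ⟨i, Nat.lt_of_succ_lt hi⟩ ⟨i + 1, hi⟩ x) = w x := by
      intro x
      simp [Schubert.mulSimple]
    refine (Equiv.swap _ _).injective (hv (hswap a hak) (hswap b hbk) ?_ ?_)
    · rw [hvk, hvs]; exact ha
    · rw [hvk, hvs]; exact hb

/-! ### The two directions of the theorem -/

/-- The fixed points are carried along because a step back from `w s_i` to `w` preserves avoidance
only by `AtMostOneLarger.of_mulSimple`, which needs them. -/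
theorem atMostOneLarger_of_eval_ne_zero {n : ℕ} (i : ℕ) (w : Equiv.Perm (Fin n))
    (h : eval (Pi.single i 1 : ℕ → ℤ) (schubert w) ≠ 0) :
    AtMostOneLarger w ∧ ∀ j : Fin n, (j : ℕ) < i → w j = j := by
  rcases Nat.lt_or_ge i n with hin | hin
  · rw [eval_single_eq_add] at h
    by_cases h1 : eval (Pi.single (i + 1) 1 : ℕ → ℤ) (schubert w) = 0
    · rw [h1, zero_add] at h
      -- The term with `∂_i` is nonzero, so `i` is neither an ascent nor out of range.
      have hi : i + 1 < n := by
        by_contra hi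
        exact h (by rw [divDiff_schubert_of_le w (by omega), map_zero])
      have hd : w ⟨i + 1, hi⟩ < w ⟨i, Nat.lt_of_succ_lt hi⟩ :=
        descent_of_not_isAscent (fun ⟨_, hasc⟩ =>
          h (by rw [divDiff_schubert_of_isAscent w i hi hasc, map_zero])) hi
      rw [divDiff_schubert_of_descent w i hi hd] at h
      obtain ⟨hv, hfix⟩ := atMostOneLarger_of_eval_ne_zero (i + 1) _ h
      refine ⟨hv.of_mulSimple i hi hfix, fun j hj => ?_⟩
      rw [← mulSimple_of_ne w i hi (by omega) (by omega)]
      exact hfix j (by omega)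
    · obtain ⟨hw, hfix⟩ := atMostOneLarger_of_eval_ne_zero (i + 1) w h1
      exact ⟨hw, fun j hj => hfix j (by omega)⟩
  -- No variable with index at least `n` occurs, so the value is the constant term. It is nonzero
  -- only in degree `0`, that is, for the identity.
  · rw [eval_eq_constantCoeff] at h
    · have h0 : ∑ p, lehmer w p = 0 := by
        by_contra h0
        exact h (constantCoeff_eq_zero_of_isHomogeneous (isHomogeneous_schubert w) h0)
      obtain rfl := eq_one_of_lehmer_eq_zero (w := w) (by simpa using h0)
      refine ⟨fun a b k hak _ ha _ => absurd ha hak.not_gt, fun j _ => rfl⟩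
    · intro j hj
      have h1 := mem_vars_iff_degreeOf_ne_zero.mp hj
      have h2 := degreeOf_schubert_le w j
      exact Pi.single_eq_of_ne (by omega) _
termination_by n - i

/-! ### The product formula for avoiding permutations. -/

theorem AtMostOneLarger.lehmer_eq_zero_of_lt {n : ℕ} {w : Equiv.Perm (Fin n)}
    (hw : AtMostOneLarger w) (i : ℕ) (hi : i + 1 < n)
    (h : w ⟨i, Nat.lt_of_succ_lt hi⟩ < w ⟨i + 1, hi⟩) :
    lehmer w ⟨i, Nat.lt_of_succ_lt hi⟩ = 0 := by
  rw [lehmer, Finset.card_eq_zero, Finset.filter_eq_empty_iff]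
  rintro k - ⟨hk, hlt⟩
  have hne : k ≠ ⟨i + 1, hi⟩ := by
    rintro rfl
    exact absurd hlt h.not_gt
  have hk' : (⟨i + 1, hi⟩ : Fin n) < k := lt_of_le_of_ne hk (Ne.symm hne)
  have := hw hk hk' hlt (hlt.trans h)
  simp at this

/-- A later entry below `w (i + 1)` would have both `w i` and `w (i + 1)` as larger entries to its
left. -/
theorem AtMostOneLarger.lehmer_eq_zero_of_gt {n : ℕ} {w : Equiv.Perm (Fin n)}
    (hw : AtMostOneLarger w) (i : ℕ) (hi : i + 1 < n)
    (h : w ⟨i + 1, hi⟩ < w ⟨i, Nat.lt_of_succ_lt hi⟩) : lehmer w ⟨i + 1, hi⟩ = 0 := by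
  rw [lehmer, Finset.card_eq_zero, Finset.filter_eq_empty_iff]
  rintro k - ⟨hk, hlt⟩
  have := hw hk (lt_trans (by simp) hk) hlt (hlt.trans h)
  simp at this

/-- The divided difference of a complete homogeneous monomial only sees one factor. -/
theorem divDiff_prod_hPoly {n : ℕ} (c : Fin n → ℕ) (p : Fin n) :
    divDiff p (∏ j : Fin n, hPoly ((j : ℕ) + 1) (c j))
      = divDiff p (hPoly ((p : ℕ) + 1) (c p))
        * ∏ j ∈ Finset.univ.erase p, hPoly ((j : ℕ) + 1) (c j) := by
  rw [← Finset.mul_prod_erase _ _ (Finset.mem_univ p)]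
  refine divDiff_mul_of_simpleAct_eq _ ?_
  simp only [simpleAct, map_prod]
  refine Finset.prod_congr rfl fun j hj => simpleAct_hPoly ?_ _
  have : (j : ℕ) ≠ p := fun e => Finset.ne_of_mem_erase hj (Fin.ext e)
  omega

theorem divDiff_prod_hPoly_of_eq_zero {n : ℕ} {c : Fin n → ℕ} {i : ℕ}
    (h : ∀ hi : i < n, c ⟨i, hi⟩ = 0) :
    divDiff i (∏ j : Fin n, hPoly ((j : ℕ) + 1) (c j)) = 0 := by
  apply divDiff_eq_zero_of_simpleAct_eq
  simp only [simpleAct, map_prod]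
  refine Finset.prod_congr rfl fun j _ => ?_
  by_cases hj : (j : ℕ) = i
  · subst hj
    simp [h j.2]
  · exact simpleAct_hPoly (by omega) _

theorem schubert_eq_prod_hPoly {n : ℕ} (w : Equiv.Perm (Fin n)) (hw : AtMostOneLarger w) :
    schubert w = ∏ j : Fin n, hPoly ((j : ℕ) + 1) (lehmer w j) := by
  induction hm : ∑ p, lehmer w p generalizing w with
  | zero =>
    have h0 : ∀ p, lehmer w p = 0 := by simpa using hm
    simp [schubert_eq_one_of_lehmer_eq_zero h0, h0]
  | succ m ih =>
    refine eq_of_divDiff_eq (fun i => ?_) ?_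
    · rcases Nat.lt_or_ge (i + 1) n with hi | hi
      · by_cases hasc : IsAscent w i
        · obtain ⟨_, h⟩ := hasc
          rw [divDiff_schubert_of_isAscent w i hi h,
            divDiff_prod_hPoly_of_eq_zero fun _ => hw.lehmer_eq_zero_of_lt i hi h]
        · have h := descent_of_not_isAscent hasc hi
          have hasc' : mulSimple w i hi ⟨i, Nat.lt_of_succ_lt hi⟩
              < mulSimple w i hi ⟨i + 1, hi⟩ := by
            rwa [mulSimple_left, mulSimple_right]
          have hcode := lehmer_mulSimple _ i hi hasc'
          have hsum := sum_lehmer_mulSimple _ i hi hasc'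
          rw [mulSimple_mulSimple] at hcode hsum
          rw [divDiff_schubert_of_descent w i hi h,
            ih _ (hw.mulSimple i hi h) (by omega)]
          have hb := hw.lehmer_eq_zero_of_gt i hi h
          set v := mulSimple w i hi
          set a : Fin n := ⟨i, Nat.lt_of_succ_lt hi⟩ with ha
          set b : Fin n := ⟨i + 1, hi⟩ with hb'
          have hab : b ≠ a := by simp [ha, hb']
          -- At positions `a, b` the code of `w` is `(d + 1, 0)` and that of `v` is `(0, d)`;
          -- elsewhere they agree. So `∂_i` of the factor at `a` becomes the factor at `b`, and the
          -- other two factors are 1.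
          have ca : lehmer w a = lehmer v b + 1 := by simpa using hcode b
          have cb : lehmer v a = 0 := by
            have := hcode a
            rw [Equiv.swap_apply_left, hb, if_neg hab.symm] at this
            simpa using this.symm
          have hmem : b ∈ Finset.univ.erase a := by simp [hab]
          refine Eq.trans ?_ (divDiff_prod_hPoly (lehmer w) a).symm
          rw [← Finset.mul_prod_erase _ _ (Finset.mem_univ a),
            ← Finset.mul_prod_erase _ _ hmem, ← Finset.mul_prod_erase _ _ hmem, ca, cb, hb]
          have hd : divDiff a (hPoly ((a : ℕ) + 1) (lehmer v b + 1))
              = hPoly ((b : ℕ) + 1) (lehmer v b) := divDiff_hPoly_succ i _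
          rw [hd, hPoly_zero_right, hPoly_zero_right, one_mul, one_mul]
          congr 1
          refine Finset.prod_congr rfl fun j hj => ?_
          simp only [Finset.mem_erase, Finset.mem_univ, and_true] at hj
          have := hcode j
          rw [Equiv.swap_apply_of_ne_of_ne hj.2 hj.1, if_neg hj.1, add_zero] at this
          rw [this]
      · rw [divDiff_schubert_of_le w hi, divDiff_prod_hPoly_of_eq_zero]
        -- Here `i` can only be the last position, where the code is `0`.
        intro hi'
        rw [lehmer, Finset.card_eq_zero, Finset.filter_eq_empty_iff]
        rintro k - ⟨hk, -⟩
        have : i < (k : ℕ) := hk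
        omega
    · rw [constantCoeff_eq_zero_of_isHomogeneous (isHomogeneous_schubert w) (by omega)]
      obtain ⟨p, -, hp⟩ := Finset.exists_ne_zero_of_sum_ne_zero (by omega : ∑ p, lehmer w p ≠ 0)
      obtain ⟨d, hd⟩ := Nat.exists_eq_succ_of_ne_zero hp
      rw [map_prod]
      refine (Finset.prod_eq_zero (Finset.mem_univ p) ?_).symm
      rw [hd]
      exact constantCoeff_hPoly_succ _ _

end Schubert

theorem theorem3 (n : ℕ) (w : Equiv.Perm (Fin n)) :
    ((∃ a : ℕ →₀ ℕ, Schubert.schubert w = Schubert.chm a) ↔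
      (Schubert.Avoids w ![3, 2, 1] ∧ Schubert.Avoids w ![2, 3, 1])) ∧
    (Schubert.Avoids w ![3, 2, 1] ∧ Schubert.Avoids w ![2, 3, 1] →
      Schubert.schubert w = Schubert.chm (Schubert.lehmerSeq w) ∧
      Schubert.chm (Schubert.lehmerSeq w) =
        ∏ i : Fin n, Schubert.hPoly ((i : ℕ) + 1) (Schubert.lehmer w i)) := by
  rw [Schubert.avoids_iff_atMostOneLarger]
  have key : Schubert.AtMostOneLarger w →
      Schubert.schubert w = Schubert.chm (Schubert.lehmerSeq w) := fun hw =>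
    (Schubert.schubert_eq_prod_hPoly w hw).trans (Schubert.chm_lehmerSeq w).symm
  refine ⟨⟨?_, fun hw => ⟨_, key hw⟩⟩, fun hw => ⟨key hw, Schubert.chm_lehmerSeq w⟩⟩
  rintro ⟨a, ha⟩
  -- At index `0` the fixed-point conclusion is vacuous and only avoidance is left.
  refine (Schubert.atMostOneLarger_of_eval_ne_zero 0 w ?_).1
  rw [ha, Schubert.eval_single_zero_chm]
  exact one_ne_zero
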